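/- Let $m,n\ge 1$ and let $A$ be a real $m\times n$ matrix. Let $\|\cdot\|$ denote the maximum norm. The Diophantine exponent $\omega(A)\in[-\infty,\infty]$ is the supremum of all $\omega\in\mathbb R$ such that there are infinitely many pairs $(\mathbf p,\mathbf q)\in\mathbb Z^m\times\mathbb Z^n$ with $\mathbf q\neq \mathbf 0$ and $\|A\mathbf q+\mathbf p\|\le\|\mathbf q\|^{-\omega}$; $A$ is called very well approximable if $\omega(A)>n/m$. Theorem. The matrix $A$ is not very well approximable if and only if for every $\varepsilon>0$ there is a constant $c>0$ such that for all sufficiently large real $Q$ and all $\boldsymbol\gamma\in\mathbb R^m$ (how large $Q$ must be does not depend on $\boldsymbol\gamma$) there exist $\mathbf q\in\mathbb Z^n$ with $\|\mathbf q\|<Q$ and $\mathbf p\in\mathbb Z^m$ satisfying $$\|A\mathbf q-\mathbf p-\boldsymbol\gamma\|<\frac{c}{Q^{\,n/m-\varepsilon}}.$$ -/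

import Mathlib

noncomputable section

/-- The product `A q` of a real `m × n` matrix with an integer vector. -/
def matMulInt {m n : ℕ} (A : Matrix (Fin m) (Fin n) ℝ) (q : Fin n → ℤ) : Fin m → ℝ :=
  A.mulVec (fun j => (q j : ℝ))

/-- An integer vector viewed as a real vector. -/
def intVec {m : ℕ} (p : Fin m → ℤ) : Fin m → ℝ := fun i => (p i : ℝ)

/-- The pairs `(p, q) ∈ ℤ^m × ℤ^n`, `q ≠ 0`, with `‖A q + p‖ ≤ ‖q‖ ^ (-w)`.
All norms here are maximum norms. -/
def approxPairs {m n : ℕ} (A : Matrix (Fin m) (Fin n) ℝ) (w : ℝ) :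
    Set ((Fin m → ℤ) × (Fin n → ℤ)) :=
  {x | x.2 ≠ 0 ∧ ‖matMulInt A x.2 + intVec x.1‖ ≤ ‖x.2‖ ^ (-w)}

/-- The Diophantine exponent `ω(A)`: the supremum, in the extended reals, of all real `w`
such that `‖A q + p‖ ≤ ‖q‖ ^ (-w)` has infinitely many integer solutions `(p, q)`. -/
def diophantineExponent {m n : ℕ} (A : Matrix (Fin m) (Fin n) ℝ) : EReal :=
  sSup {x : EReal | ∃ w : ℝ, (approxPairs A w).Infinite ∧ x = (w : EReal)}

/-- An `m × n` matrix is very well approximable if its Diophantine exponent exceeds `n / m`. -/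
def VeryWellApproximable {m n : ℕ} (A : Matrix (Fin m) (Fin n) ℝ) : Prop :=
  (((n : ℝ) / (m : ℝ) : ℝ) : EReal) < diophantineExponent A

end

/-! ### Integer vectors and the maximum norm. -/

section MaxNorm

/-! If `A` is not very well approximable, the points `A q`, `‖q‖ ≤ T`, are separated modulo `ℤ^m` by
`s ≈ T^(-n/m - μ/m)` with `μ` small, nearly the best possible for about `T^n` points of a torus.
Consider the points reached in `k` steps, each adding some such `A q` and an error below `s`. While
they do not fill space, connectedness yields new points `γ_j`, two levels apart, around which the
translated clouds `γ_j + A q` stay `s`-separated. The packing bound `card_le_of_separated` allows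
only about `T^μ` of them, so (`reachable_eq_univ`) every point is reached with `‖q‖ ≲ T^(1+μ)` and
error `≲ T^(μ - n/m)`.

Conversely, let `q₀` be an unusually good approximation of norm `T`, and let `Q` be slightly larger
than `T`. Subtracting multiples of `q₀` from `q` hardly moves `A q` modulo `ℤ^m`, so up to a small
error the vectors `‖q‖ < Q` give only about `T * Q^(n-1)` points instead of `Q^n`, too few for the
assumed density (`pow_mul_le_of_dense`). -/

theorem matMulInt_add {m n : ℕ} (A : Matrix (Fin m) (Fin n) ℝ) (q q' : Fin n → ℤ) :
    matMulInt A (q + q') = matMulInt A q + matMulInt A q' := by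
  unfold matMulInt
  rw [← Matrix.mulVec_add]
  congr 1
  ext j
  simp

theorem matMulInt_zsmul {m n : ℕ} (A : Matrix (Fin m) (Fin n) ℝ) (k : ℤ) (q : Fin n → ℤ) :
    matMulInt A (k • q) = (k : ℝ) • matMulInt A q := by
  unfold matMulInt
  rw [← Matrix.mulVec_smul]
  congr 1
  ext j
  simp

theorem matMulInt_sub {m n : ℕ} (A : Matrix (Fin m) (Fin n) ℝ) (q q' : Fin n → ℤ) :
    matMulInt A (q - q') = matMulInt A q - matMulInt A q' := by
  rw [eq_sub_iff_add_eq, ← matMulInt_add, sub_add_cancel]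

theorem matMulInt_zero {m n : ℕ} (A : Matrix (Fin m) (Fin n) ℝ) :
    matMulInt A 0 = 0 := by
  simpa using matMulInt_sub A 0 0

theorem intVec_add {m : ℕ} (p p' : Fin m → ℤ) : intVec (p + p') = intVec p + intVec p' := by
  ext i; simp [intVec]

theorem intVec_sub {m : ℕ} (p p' : Fin m → ℤ) : intVec (p - p') = intVec p - intVec p' := by
  ext i; simp [intVec]

theorem intVec_neg {m : ℕ} (p : Fin m → ℤ) : intVec (-p) = -intVec p := by
  ext i; simp [intVec]

theorem intVec_zsmul {m : ℕ} (k : ℤ) (p : Fin m → ℤ) :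
    intVec (k • p) = (k : ℝ) • intVec p := by
  ext i; simp [intVec]

theorem intVec_zero {m : ℕ} : intVec (0 : Fin m → ℤ) = 0 := by
  ext i; simp [intVec]

theorem abs_cast_le_norm {n : ℕ} (q : Fin n → ℤ) (i : Fin n) : |(q i : ℝ)| ≤ ‖q‖ := by
  have := norm_le_pi_norm q i
  rwa [Int.norm_eq_abs] at this

theorem one_le_norm_of_ne_zero {n : ℕ} {q : Fin n → ℤ} (hq : q ≠ 0) : 1 ≤ ‖q‖ := by
  obtain ⟨i, hi⟩ := Function.ne_iff.mp hq
  refine le_trans ?_ (abs_cast_le_norm q i)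
  exact_mod_cast Int.one_le_abs hi

theorem exists_abs_eq_norm {n : ℕ} (hn : 0 < n) (q : Fin n → ℤ) :
    ∃ i, |(q i : ℝ)| = ‖q‖ := by
  have : Nonempty (Fin n) := ⟨⟨0, hn⟩⟩
  obtain ⟨i, hi⟩ := Finite.exists_max fun i => ‖q i‖
  refine ⟨i, le_antisymm (abs_cast_le_norm q i) ?_⟩
  rw [← Int.norm_eq_abs]
  exact (pi_norm_le_iff_of_nonneg (norm_nonneg _)).2 hi

theorem intVec_norm {m : ℕ} (p : Fin m → ℤ) : ‖intVec p‖ = ‖p‖ := by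
  apply le_antisymm
  · exact (pi_norm_le_iff_of_nonneg (norm_nonneg _)).2 fun i => abs_cast_le_norm p i
  · refine (pi_norm_le_iff_of_nonneg (norm_nonneg _)).2 fun i => ?_
    rw [Int.norm_eq_abs]
    exact norm_le_pi_norm (intVec p) i

end MaxNorm

/-! ### Packing in the torus. -/

section Packing

/-- A family of points that is `s`-separated modulo `ℤ^m` has at most `(2 / s) ^ m` members. -/
theorem card_le_of_separated {m : ℕ} {ι : Type*} [Fintype ι] (x : ι → Fin m → ℝ) {s : ℝ}
    (hs : 0 < s) (hs1 : s ≤ 1)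
    (h : ∀ i j, i ≠ j → ∀ p : Fin m → ℤ, s ≤ ‖x i - x j - intVec p‖) :
    (Fintype.card ι : ℝ) ≤ (2 / s) ^ m := by
  -- Pigeonhole on `K^m` half-open boxes of side `1 / K ≤ s`: two points in one box are closer than
  -- `s`.
  set K : ℕ := ⌈1 / s⌉₊ with hK
  have h1s : 1 ≤ 1 / s := by rw [le_div_iff₀ hs]; linarith
  have hKs : 1 / s ≤ (K : ℝ) := Nat.le_ceil _
  have hK0 : (0 : ℝ) < K := by linarith
  have hK2 : (K : ℝ) ≤ 2 / s := by
    have := Nat.ceil_lt_add_one (show 0 ≤ 1 / s by positivity)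
    have e : 2 / s = 1 / s + 1 / s := by ring
    rw [e]; linarith
  have hcell (i : ι) (a : Fin m) : ⌊Int.fract (x i a) * K⌋₊ < K := by
    rw [Nat.floor_lt (mul_nonneg (Int.fract_nonneg _) hK0.le)]
    have := Int.fract_lt_one (x i a)
    nlinarith
  let f : ι → Fin m → Fin K := fun i a => ⟨⌊Int.fract (x i a) * K⌋₊, hcell i a⟩
  have hf : Function.Injective f := by
    intro i j hij
    by_contra hne
    have := h i j hne fun a => ⌊x i a⌋ - ⌊x j a⌋
    refine absurd this (not_le.2 ((pi_norm_lt_iff hs).2 fun a => ?_))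
    have e : ⌊Int.fract (x i a) * K⌋₊ = ⌊Int.fract (x j a) * K⌋₊ :=
      congrArg Fin.val (congrFun hij a)
    have i1 := Nat.floor_le (mul_nonneg (Int.fract_nonneg (x i a)) hK0.le)
    have i2 := Nat.lt_floor_add_one (Int.fract (x i a) * K)
    have j1 := Nat.floor_le (mul_nonneg (Int.fract_nonneg (x j a)) hK0.le)
    have j2 := Nat.lt_floor_add_one (Int.fract (x j a) * K)
    rw [e] at i1 i2
    have e2 : (x i - x j - intVec fun a => ⌊x i a⌋ - ⌊x j a⌋) a
        = Int.fract (x i a) - Int.fract (x j a) := by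
      simp only [Pi.sub_apply, intVec, Int.fract]; push_cast; ring
    rw [e2, Real.norm_eq_abs]
    have hlt : |Int.fract (x i a) - Int.fract (x j a)| * K < 1 := by
      rw [← abs_of_pos hK0, ← abs_mul, abs_lt]
      constructor <;> linarith
    have hsK : 1 ≤ s * K := by
      rw [div_le_iff₀ hs] at hKs; linarith
    by_contra hcon
    rw [not_lt] at hcon
    nlinarith
  have hcard := Fintype.card_le_of_injective f hf
  simp only [Fintype.card_fun, Fintype.card_fin] at hcard
  calc (Fintype.card ι : ℝ) ≤ (K : ℝ) ^ m := by exact_mod_cast hcard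
    _ ≤ _ := by gcongr

end Packing

/-! ### From separation to inhomogeneous approximation. -/

section Transference

/-- If `ω(A) < w` in the strong sense that `A` has only finitely many `w`-approximations, then
`A` satisfies a uniform Diophantine condition with exponent `w`. -/
theorem exists_lower_bound_of_finite {m n : ℕ} (A : Matrix (Fin m) (Fin n) ℝ) {w : ℝ}
    (hfin : (approxPairs A w).Finite) :
    ∃ C : ℝ, 0 < C ∧ C ≤ 1 ∧ ∀ (q : Fin n → ℤ) (p : Fin m → ℤ), q ≠ 0 →
      C * ‖q‖ ^ (-w) ≤ ‖matMulInt A q + intVec p‖ := by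
  have hne : ∀ (q : Fin n → ℤ) (p : Fin m → ℤ), q ≠ 0 → matMulInt A q + intVec p ≠ 0 := by
    intro q p hq h0
    -- An exact solution would have infinitely many multiples, all of them in `approxPairs A w`.
    have hinj : Function.Injective fun k : ℕ => ((((k : ℤ) + 1) • p, ((k : ℤ) + 1) • q) :
        (Fin m → ℤ) × (Fin n → ℤ)) := by
      intro k l hkl
      have h2 := congrArg Prod.snd hkl
      simp only at h2
      have := smul_left_injective ℤ hq h2
      omega
    refine Set.infinite_of_injective_forall_mem hinj (fun k => ?_) hfin
    refine ⟨smul_ne_zero (by omega) hq, ?_⟩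
    rw [matMulInt_zsmul, intVec_zsmul, ← smul_add, h0, smul_zero, norm_zero]
    positivity
  have key : ∃ C : ℝ, 0 < C ∧ ∀ x ∈ approxPairs A w,
      C * ‖x.2‖ ^ (-w) ≤ ‖matMulInt A x.2 + intVec x.1‖ := by
    rcases (approxPairs A w).eq_empty_or_nonempty with he | hne'
    · exact ⟨1, one_pos, by simp [he]⟩
    obtain ⟨y, hy, hmin⟩ := Set.exists_min_image _
      (fun x : (Fin m → ℤ) × (Fin n → ℤ) => ‖matMulInt A x.2 + intVec x.1‖ / ‖x.2‖ ^ (-w)) hfin hne'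
    have hpos (x) (hx : x ∈ approxPairs A w) : 0 < ‖x.2‖ ^ (-w) :=
      Real.rpow_pos_of_pos (by linarith [one_le_norm_of_ne_zero hx.1]) _
    have hy0 : 0 < ‖matMulInt A y.2 + intVec y.1‖ := norm_pos_iff.2 (hne y.2 y.1 hy.1)
    refine ⟨‖matMulInt A y.2 + intVec y.1‖ / ‖y.2‖ ^ (-w), div_pos hy0 (hpos y hy), ?_⟩
    intro x hx
    rw [← le_div_iff₀ (hpos x hx)]
    exact hmin x hx
  obtain ⟨C, hC, hCx⟩ := key
  refine ⟨min C 1, by positivity, min_le_right _ _, fun q p hq => ?_⟩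
  have hq0 : 0 ≤ ‖q‖ ^ (-w) := by positivity
  by_cases hmem : (p, q) ∈ approxPairs A w
  · have h1 := hCx _ hmem
    have h2 := mul_le_mul_of_nonneg_right (min_le_left C 1) hq0
    exact h2.trans h1
  · have : ‖q‖ ^ (-w) < ‖matMulInt A q + intVec p‖ := by
      by_contra hcon
      exact hmem ⟨hq, not_lt.1 hcon⟩
    nlinarith [min_le_right C 1]

/-- The points of `ℝ^m` that lie within distance `k * s`, modulo `ℤ^m`, of some `A q` with
`‖q‖ ≤ k * T`. -/
def reachable {m n : ℕ} (A : Matrix (Fin m) (Fin n) ℝ) (T s : ℝ) (k : ℕ) : Set (Fin m → ℝ) :=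
  {γ | ∃ (q : Fin n → ℤ) (p : Fin m → ℤ), ‖q‖ ≤ k * T ∧ ‖matMulInt A q - intVec p - γ‖ < k * s}

theorem reachable_mono {m n : ℕ} (A : Matrix (Fin m) (Fin n) ℝ) {T s : ℝ} (hT : 0 ≤ T)
    (hs : 0 ≤ s) : Monotone (reachable A T s) := by
  rintro k l hkl γ ⟨q, p, hq, hp⟩
  have : (k : ℝ) ≤ l := by exact_mod_cast hkl
  exact ⟨q, p, hq.trans (by gcongr), hp.trans_le (by gcongr)⟩

theorem reachable_succ {m n : ℕ} (A : Matrix (Fin m) (Fin n) ℝ) {T s : ℝ} {k : ℕ}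
    {γ γ' : Fin m → ℝ} (hγ : γ ∈ reachable A T s k) {q : Fin n → ℤ} {p : Fin m → ℤ}
    (hq : ‖q‖ ≤ T) (h : ‖γ' - γ - matMulInt A q - intVec p‖ < s) :
    γ' ∈ reachable A T s (k + 1) := by
  obtain ⟨q₁, p₁, hq₁, hp₁⟩ := hγ
  refine ⟨q₁ + q, p₁ - p, (norm_add_le _ _).trans (by push_cast; linarith), ?_⟩
  rw [matMulInt_add, intVec_sub]
  have e : matMulInt A q₁ + matMulInt A q - (intVec p₁ - intVec p) - γ'
      = (matMulInt A q₁ - intVec p₁ - γ) - (γ' - γ - matMulInt A q - intVec p) := by abel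
  rw [e]
  refine (norm_sub_le _ _).trans_lt ?_
  push_cast
  linarith

theorem isOpen_reachable {m n : ℕ} (A : Matrix (Fin m) (Fin n) ℝ) (T s : ℝ) (k : ℕ) :
    IsOpen (reachable A T s k) := by
  have : reachable A T s k = ⋃ (q : Fin n → ℤ) (p : Fin m → ℤ) (_ : ‖q‖ ≤ k * T),
      Metric.ball (matMulInt A q - intVec p) (k * s) := by
    ext γ
    simp [reachable, dist_eq_norm, norm_sub_rev γ]
  rw [this]
  exact isOpen_iUnion fun q => isOpen_iUnion fun p => isOpen_iUnion fun _ => Metric.isOpen_ball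

/-- Since `ℝ^m` is connected, a nonempty proper open set is not closed; a boundary point outside it
is within `s` of it. -/
theorem exists_mem_reachable_succ {m n : ℕ} (A : Matrix (Fin m) (Fin n) ℝ) {T s : ℝ}
    (hT : 0 ≤ T) (hs : 0 < s) {k : ℕ} (hk : reachable A T s k ≠ Set.univ) :
    ∃ γ ∈ reachable A T s (k + 1), γ ∉ reachable A T s k := by
  rcases (reachable A T s k).eq_empty_or_nonempty with he | hne
  · refine ⟨0, ⟨0, 0, ?_, ?_⟩, by simp [he]⟩
    · rw [norm_zero]; positivity
    · rw [matMulInt_zero, intVec_zero, sub_zero, sub_zero, norm_zero]; positivity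
  have hcl : ¬ IsClosed (reachable A T s k) := fun hc =>
    (isClopen_iff.1 ⟨hc, isOpen_reachable A T s k⟩).elim hne.ne_empty hk
  have : ∃ γ ∈ closure (reachable A T s k), γ ∉ reachable A T s k := by
    by_contra! hcon
    exact hcl (isClosed_of_closure_subset hcon)
  obtain ⟨γ, hγ, hγ'⟩ := this
  obtain ⟨γ₀, hγ₀, hd⟩ := Metric.mem_closure_iff.1 hγ s hs
  refine ⟨γ, reachable_succ A hγ₀ (q := 0) (p := 0) (by simpa using hT) ?_, hγ'⟩
  rwa [matMulInt_zero, intVec_zero, sub_zero, sub_zero, ← dist_eq_norm]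

/-- The points `A q` with `‖q‖ ≤ 2NT` are `2Ns`-dense modulo `ℤ^m` once `N` exceeds the packing
bound for the separation `s` of the points `A q`, `‖q‖ ≤ T`. -/
theorem reachable_eq_univ {m n : ℕ} (A : Matrix (Fin m) (Fin n) ℝ) {T N : ℕ} {s : ℝ}
    (hs : 0 < s) (hs1 : s ≤ 1)
    (hsep : ∀ (q : Fin n → ℤ) (p : Fin m → ℤ), q ≠ 0 → ‖q‖ ≤ T →
      s ≤ ‖matMulInt A q + intVec p‖)
    (hN : (2 / s) ^ m < (N + 1) * (T : ℝ) ^ n) :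
    reachable A T s (2 * N) = Set.univ := by
  by_contra hne
  have hmono := reachable_mono A (T.cast_nonneg (α := ℝ)) hs.le
  have hex (j : Fin (N + 1)) :
      ∃ γ ∈ reachable A T s (2 * j + 1), γ ∉ reachable A T s (2 * j) := by
    refine exists_mem_reachable_succ A T.cast_nonneg hs fun hu => hne ?_
    exact Set.univ_subset_iff.1 (hu ▸ hmono (by omega))
  choose γ hγ hγ' using hex
  -- The box `{0, …, T-1}^n` has `T^n` elements, with differences of norm at most `T`.
  let z : (Fin n → Fin T) → Fin n → ℤ := fun v a => (v a : ℕ)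
  have hz (u v) : ‖z u - z v‖ ≤ T := by
    refine (pi_norm_le_iff_of_nonneg T.cast_nonneg).2 fun a => ?_
    rw [Int.norm_eq_abs, Pi.sub_apply]
    have h1 := (u a).2
    have h2 := (v a).2
    have : |z u a - z v a| ≤ (T : ℤ) := by simp only [z]; rw [abs_le]; omega
    exact_mod_cast this
  have hzinj : Function.Injective z := by
    intro u v huv
    ext a
    exact Int.ofNat_inj.1 (congrFun huv a)
  -- If clouds `i < j` came within `s`, one more step from `γ i` would put `γ j` in level `2i + 2 ≤
  -- 2j`, which it avoids.
  have aux : ∀ i j : Fin (N + 1), i < j → ∀ (u v : Fin n → Fin T) (p : Fin m → ℤ),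
      s ≤ ‖(γ j + matMulInt A (z u)) - (γ i + matMulInt A (z v)) - intVec p‖ := by
    intro i j hij u v p
    by_contra hcon
    rw [not_le] at hcon
    refine hγ' j (hmono (a := 2 * i + 1 + 1) ?_ (reachable_succ A (hγ i) (hz v u) (p := p) ?_))
    · have : (i : ℕ) < j := hij
      omega
    · rw [matMulInt_sub]
      have e : γ j - γ i - (matMulInt A (z v) - matMulInt A (z u)) - intVec p
          = γ j + matMulInt A (z u) - (γ i + matMulInt A (z v)) - intVec p := by abel
      rwa [e]
  have := card_le_of_separated
    (fun x : Fin (N + 1) × (Fin n → Fin T) => γ x.1 + matMulInt A (z x.2)) hs hs1 ?_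
  · simp only [Fintype.card_prod, Fintype.card_fun, Fintype.card_fin] at this
    push_cast at this
    linarith
  rintro ⟨i, u⟩ ⟨j, v⟩ hij p
  rcases lt_trichotomy i j with h | h | h
  · have := aux i j h v u (-p)
    have e : γ i + matMulInt A (z u) - (γ j + matMulInt A (z v)) - intVec p
        = -(γ j + matMulInt A (z v) - (γ i + matMulInt A (z u)) - intVec (-p)) := by
      rw [intVec_neg]; abel
    rwa [← norm_neg, ← e] at this
  · subst h
    have huv : u ≠ v := fun h => hij (by rw [h])
    have := hsep (z u - z v) (-p) (sub_ne_zero.2 (hzinj.ne huv)) (hz u v)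
    have e : γ i + matMulInt A (z u) - (γ i + matMulInt A (z v)) - intVec p
        = matMulInt A (z u - z v) + intVec (-p) := by
      rw [intVec_neg, matMulInt_sub]; abel
    rwa [← e] at this
  · exact aux j i h u v p

theorem finite_approxPairs_of_not_veryWellApproximable {m n : ℕ} {A : Matrix (Fin m) (Fin n) ℝ}
    (hA : ¬ VeryWellApproximable A) {w : ℝ} (hw : (n : ℝ) / m < w) :
    (approxPairs A w).Finite := by
  by_contra hinf
  exact hA ((EReal.coe_lt_coe_iff.2 hw).trans_le (le_sSup ⟨w, hinf, rfl⟩))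

theorem exists_infinite_approxPairs {m n : ℕ} {A : Matrix (Fin m) (Fin n) ℝ}
    (hA : VeryWellApproximable A) : ∃ w : ℝ, (n : ℝ) / m < w ∧ (approxPairs A w).Infinite := by
  obtain ⟨_, ⟨w, hw, rfl⟩, h⟩ := lt_sSup_iff.1 hA
  exact ⟨w, EReal.coe_lt_coe_iff.1 h, hw⟩

/-- The inhomogeneous approximation property of a matrix that is not very well approximable. -/
theorem exists_inhomogeneous_approx {m n : ℕ} (hm : 0 < m) (hn : 0 < n)
    {A : Matrix (Fin m) (Fin n) ℝ} (hA : ¬ VeryWellApproximable A) {ε : ℝ} (hε : 0 < ε) :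
    ∃ c : ℝ, 0 < c ∧ ∃ Q₀ : ℝ, 0 < Q₀ ∧ ∀ Q : ℝ, Q₀ ≤ Q →
      ∀ γ : Fin m → ℝ, ∃ (q : Fin n → ℤ) (p : Fin m → ℤ),
        ‖q‖ < Q ∧ ‖matMulInt A q - intVec p - γ‖ < c / Q ^ ((n : ℝ) / (m : ℝ) - ε) := by
  have hm' : (0 : ℝ) < m := by exact_mod_cast hm
  have hn' : (0 : ℝ) < n := by exact_mod_cast hn
  obtain ⟨a, ha⟩ : ∃ a : ℝ, a = n / m := ⟨_, rfl⟩
  have ha0 : 0 < a := by rw [ha]; positivity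
  have ham : a * m = n := by rw [ha]; field_simp
  rw [← ha]
  -- The last bound gives `a - ε ≤ (a - μ) / (1 + μ)`, the exponent reached below; `μ ≤ a` keeps `a
  -- - μ` nonnegative.
  obtain ⟨μ, hμ0, hμa, hμε⟩ : ∃ μ : ℝ, 0 < μ ∧ μ ≤ a ∧ μ * (1 + a) ≤ ε := by
    refine ⟨min a (ε / (1 + a)), by positivity, min_le_left _ _, ?_⟩
    rw [← le_div_iff₀ (by positivity)]
    exact min_le_right _ _
  obtain ⟨C, hC0, hC1, hC⟩ := exists_lower_bound_of_finite A
    (finite_approxPairs_of_not_veryWellApproximable hA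
      (show (n : ℝ) / m < a + μ / m by rw [← ha]; linarith [div_pos hμ0 hm']))
  set w := a + μ / m with hw
  have hw0 : 0 < w := by positivity
  have hwm : w * m = n + μ := by rw [hw, add_mul, ham]; field_simp
  set D : ℝ := 2 * (2 / C) ^ m with hD
  have hD0 : 0 < D := by positivity
  set κ : ℝ := ((1 / (2 * D)) ^ (1 / (1 + μ)) / 2) ^ (a - μ) with hκ
  have hκ0 : 0 < κ := by positivity
  refine ⟨D / κ, by positivity, max 1 (2 * D), by positivity, fun Q hQ γ => ?_⟩
  have hQ1 : 1 ≤ Q := (le_max_left _ _).trans hQ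
  have hQD : 2 * D ≤ Q := (le_max_right _ _).trans hQ
  have hQ0 : 0 < Q := by linarith
  -- Solves `D * X^(1+μ) = Q / 2`, which bounds `2 * N * T`. The constant `κ` absorbs `2 * D` and
  -- the rounding loss `T ≥ X / 2`.
  set X : ℝ := (Q / (2 * D)) ^ (1 / (1 + μ)) with hX
  have hX1 : 1 ≤ X := Real.one_le_rpow ((one_le_div (by positivity)).2 hQD) (by positivity)
  set T : ℕ := ⌊X⌋₊ with hT
  have hTX : (T : ℝ) ≤ X := Nat.floor_le (by linarith)
  have hXT : X < T + 1 := Nat.lt_floor_add_one X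
  have hT1 : (1 : ℝ) ≤ T := by exact_mod_cast (Nat.one_le_floor_iff X).2 hX1
  have hT0 : (0 : ℝ) < T := by linarith
  set s : ℝ := C * (T : ℝ) ^ (-w) with hs
  have hs0 : 0 < s := by positivity
  have hTw : (T : ℝ) ^ (-w) ≤ 1 := Real.rpow_le_one_of_one_le_of_nonpos hT1 (by linarith)
  have hs1 : s ≤ 1 := by
    have : (0 : ℝ) ≤ (T : ℝ) ^ (-w) := by positivity
    rw [hs]; nlinarith
  set N : ℕ := ⌊(2 / s) ^ m / (T : ℝ) ^ n⌋₊ with hN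
  have hNlt : (2 / s) ^ m < (N + 1) * (T : ℝ) ^ n := by
    rw [← div_lt_iff₀ (by positivity)]
    exact Nat.lt_floor_add_one _
  have hNle : 2 * (N : ℝ) ≤ D * (T : ℝ) ^ μ := by
    have h1 : (N : ℝ) ≤ (2 / s) ^ m / (T : ℝ) ^ n := Nat.floor_le (by positivity)
    have h2 : (2 / s) ^ m / (T : ℝ) ^ n = (2 / C) ^ m * (T : ℝ) ^ μ := by
      have e1 : 2 / s = 2 / C * (T : ℝ) ^ w := by
        rw [hs, Real.rpow_neg hT0.le]; field_simp
      have e2 : ((T : ℝ) ^ w) ^ m = (T : ℝ) ^ n * (T : ℝ) ^ μ := by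
        rw [← Real.rpow_natCast, ← Real.rpow_mul hT0.le, hwm, Real.rpow_add hT0,
          Real.rpow_natCast]
      rw [e1, mul_pow, e2]
      field_simp
    rw [hD]
    linarith
  have huniv := reachable_eq_univ A hs0 hs1 (fun q p hq hqT => ?_) hNlt
  swap
  · refine le_trans ?_ (hC q p hq)
    have hq1 := one_le_norm_of_ne_zero hq
    exact mul_le_mul_of_nonneg_left
      (Real.rpow_le_rpow_of_nonpos (by linarith) hqT (by linarith)) hC0.le
  obtain ⟨q, p, hq, hp⟩ : γ ∈ reachable A T s (2 * N) := huniv ▸ Set.mem_univ γ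
  push_cast at hq hp
  refine ⟨q, p, hq.trans_lt ?_, hp.trans_le ?_⟩
  · have hpow : (T : ℝ) ^ (1 + μ) ≤ Q / (2 * D) := by
      calc (T : ℝ) ^ (1 + μ) ≤ X ^ (1 + μ) := by gcongr
        _ = Q / (2 * D) := by
          rw [hX, ← Real.rpow_mul (by positivity), one_div_mul_cancel (by positivity),
            Real.rpow_one]
    calc 2 * (N : ℝ) * T ≤ D * (T : ℝ) ^ μ * T := by gcongr
      _ = D * (T : ℝ) ^ (1 + μ) := by rw [Real.rpow_add hT0, Real.rpow_one]; ring
      _ ≤ D * (Q / (2 * D)) := by gcongr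
      _ = Q / 2 := by field_simp
      _ < Q := by linarith
  · have hsT : s ≤ (T : ℝ) ^ (-a) := by
      calc s ≤ 1 * (T : ℝ) ^ (-w) := by rw [hs]; gcongr
        _ ≤ (T : ℝ) ^ (-a) := by
          rw [one_mul]
          exact Real.rpow_le_rpow_of_exponent_le hT1 (by
            rw [hw]; linarith [div_pos hμ0 hm'])
    have hκT : κ * Q ^ (a - ε) ≤ (T : ℝ) ^ (a - μ) := by
      calc κ * Q ^ (a - ε) ≤ κ * Q ^ (1 / (1 + μ) * (a - μ)) := by
            refine mul_le_mul_of_nonneg_left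
              (Real.rpow_le_rpow_of_exponent_le hQ1 ?_) hκ0.le
            · rw [one_div_mul_eq_div, le_div_iff₀ (by positivity)]
              nlinarith
        _ = (X / 2) ^ (a - μ) := by
            rw [Real.rpow_mul hQ0.le, hκ, ← Real.mul_rpow (by positivity) (by positivity)]
            congr 1
            rw [hX, div_eq_mul_one_div Q, Real.mul_rpow hQ0.le (by positivity)]
            ring
        _ ≤ (T : ℝ) ^ (a - μ) :=
            Real.rpow_le_rpow (by positivity) (by linarith) (by linarith)
    calc 2 * (N : ℝ) * s ≤ D * (T : ℝ) ^ μ * (T : ℝ) ^ (-a) := by gcongr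
      _ = D / (T : ℝ) ^ (a - μ) := by
          rw [mul_assoc, ← Real.rpow_add hT0, div_eq_mul_inv, ← Real.rpow_neg hT0.le]
          congr 2; ring
      _ ≤ D / (κ * Q ^ (a - ε)) := by gcongr
      _ = D / κ / Q ^ (a - ε) := by rw [div_div]

end Transference

/-! ### Counting against a very good approximation. -/

section Converse

/-- If every point is `δ`-close modulo `ℤ^m` to some `A q` with `‖q‖ < Q`, and `A q₀` is very close
to an integer vector, then counting the vectors `q` modulo `q₀` bounds `δ` from below. -/
theorem pow_mul_le_of_dense {m n : ℕ} (hn : 0 < n) {A : Matrix (Fin m) (Fin n) ℝ}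
    {q₀ : Fin n → ℤ} {p₀ : Fin m → ℤ} (hq₀ : q₀ ≠ 0) {Q δ : ℝ} (hQ : ‖q₀‖ ≤ Q) {K : ℕ}
    (hK : 4 * δ * K ≤ 1)
    (hsmall : 2 * (Q / ‖q₀‖) * ‖matMulInt A q₀ + intVec p₀‖ ≤ δ)
    (hdense : ∀ γ : Fin m → ℝ, ∃ (q : Fin n → ℤ) (p : Fin m → ℤ),
      ‖q‖ < Q ∧ ‖matMulInt A q - intVec p - γ‖ < δ) :
    (K : ℝ) ^ m * (7 * Q) ≤ ‖q₀‖ * (7 * Q) ^ n := by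
  have hT1 := one_le_norm_of_ne_zero hq₀
  have hQ1 : 1 ≤ Q := hT1.trans hQ
  obtain ⟨i₀, hi₀⟩ := exists_abs_eq_norm hn q₀
  have ht0 : q₀ i₀ ≠ 0 := by
    intro h
    rw [h] at hi₀
    simp at hi₀
    linarith
  let grid : (Fin m → Fin K) → Fin m → ℝ := fun v a => (v a : ℕ) / (K : ℝ)
  choose q p hq hp using fun v => hdense (grid v)
  -- Division with remainder in a coordinate where `|q₀|` is maximal, so that `|l|` is at most `2 *
  -- Q / ‖q₀‖`.
  let l : (Fin m → Fin K) → ℤ := fun v => q v i₀ / q₀ i₀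
  let r : (Fin m → Fin K) → Fin n → ℤ := fun v => q v - l v • q₀
  have hlT (v) : |(l v : ℝ)| * ‖q₀‖ ≤ 2 * Q := by
    have h1 : l v * q₀ i₀ = q v i₀ - q v i₀ % q₀ i₀ := by
      have := Int.emod_add_mul_ediv (q v i₀) (q₀ i₀)
      linear_combination this
    have h2 := Int.emod_nonneg (q v i₀) ht0
    have h3 := Int.emod_lt_abs (q v i₀) ht0
    have h4 : |l v * q₀ i₀| ≤ |q v i₀| + |q₀ i₀| := by
      rw [h1]
      refine (abs_sub _ _).trans ?_
      rw [abs_of_nonneg h2]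
      linarith
    have h5 : |(l v : ℝ)| * |(q₀ i₀ : ℝ)| ≤ |(q v i₀ : ℝ)| + |(q₀ i₀ : ℝ)| := by
      rw [← abs_mul]; exact_mod_cast h4
    rw [hi₀] at h5
    linarith [abs_cast_le_norm (q v) i₀, hq v]
  have hclose (v) : ‖matMulInt A (r v) - intVec (p v + l v • p₀) - grid v‖ < 2 * δ := by
    have e : matMulInt A (r v) - intVec (p v + l v • p₀) - grid v
        = (matMulInt A (q v) - intVec (p v) - grid v)
          - (l v : ℝ) • (matMulInt A q₀ + intVec p₀) := by
      simp only [r]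
      rw [matMulInt_sub, matMulInt_zsmul, intVec_add, intVec_zsmul, smul_add]
      abel
    rw [e]
    refine (norm_sub_le _ _).trans_lt ?_
    rw [norm_smul, Real.norm_eq_abs]
    have h1 : |(l v : ℝ)| ≤ 2 * (Q / ‖q₀‖) := by
      rw [← mul_div_assoc, le_div_iff₀ (by linarith)]
      exact hlT v
    have h2 := mul_le_mul_of_nonneg_right h1 (norm_nonneg (matMulInt A q₀ + intVec p₀))
    linarith [hp v]
  -- Equal remainders would put two grid points within `4 * δ ≤ 1 / K` modulo `ℤ^m`, the spacing of
  -- the grid.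
  have hinj : Function.Injective r := by
    intro u v huv
    ext a
    have hK0 : (0 : ℝ) < K := by exact_mod_cast (u a).pos
    set P : Fin m → ℤ := (p v + l v • p₀) - (p u + l u • p₀) with hP
    have hlt : ‖intVec P + (grid v - grid u)‖ < 4 * δ := by
      have e : intVec P + (grid v - grid u)
          = (matMulInt A (r u) - intVec (p u + l u • p₀) - grid u)
            - (matMulInt A (r v) - intVec (p v + l v • p₀) - grid v) := by
        rw [huv, hP, intVec_sub]
        abel
      rw [e]
      refine (norm_sub_le _ _).trans_lt ?_
      linarith [hclose u, hclose v]
    have h1 : |(P a : ℝ) + ((v a : ℕ) / (K : ℝ) - (u a : ℕ) / (K : ℝ))| < 4 * δ :=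
      (norm_le_pi_norm (intVec P + (grid v - grid u)) a).trans_lt hlt
    have h2 : |(P a : ℝ) * K + ((v a : ℕ) - (u a : ℕ))| < 1 := by
      calc |(P a : ℝ) * K + ((v a : ℕ) - (u a : ℕ))|
          = |(P a : ℝ) + ((v a : ℕ) / (K : ℝ) - (u a : ℕ) / (K : ℝ))| * K := by
            rw [← abs_of_pos hK0, ← abs_mul, abs_of_pos hK0]
            congr 1
            field_simp
        _ < 4 * δ * K := by gcongr
        _ ≤ 1 := hK
    have h3 : P a * K + (((v a : ℕ) : ℤ) - ((u a : ℕ) : ℤ)) = 0 := by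
      rw [← Int.abs_lt_one_iff]
      exact_mod_cast h2
    have h4 : ((u a : ℕ) : ℤ) - ((v a : ℕ) : ℤ) = 0 := by
      refine Int.eq_zero_of_abs_lt_dvd (m := K) ⟨P a, by linear_combination -h3⟩ ?_
      have := (u a).2
      have := (v a).2
      rw [abs_lt]
      omega
    omega
  -- Remainders have `|r j| ≤ Q + 2 * Q`, while coordinate `i₀` takes only `‖q₀‖` values; this is
  -- the saving over `Q^n`.
  set M : ℕ := ⌊3 * Q⌋₊ with hM
  let S : Finset (Fin n → ℤ) := Fintype.piFinset fun j =>
    if j = i₀ then Finset.Ico 0 |q₀ i₀| else Finset.Icc (-(M : ℤ)) M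
  have hmem (v) : r v ∈ S := by
    rw [Fintype.mem_piFinset]
    intro j
    split_ifs with hj
    · rw [hj]
      have e : r v i₀ = q v i₀ % q₀ i₀ := by
        have := Int.emod_add_mul_ediv (q v i₀) (q₀ i₀)
        simp only [r, l, Pi.sub_apply, Pi.smul_apply, smul_eq_mul]
        linear_combination -this
      rw [e, Finset.mem_Ico]
      exact ⟨Int.emod_nonneg _ ht0, Int.emod_lt_abs _ ht0⟩
    · have h1 : |(r v j : ℝ)| ≤ 3 * Q := by
        have e : (r v j : ℝ) = q v j - l v * q₀ j := by simp [r]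
        rw [e]
        refine (abs_sub _ _).trans ?_
        rw [abs_mul]
        have := mul_le_mul_of_nonneg_left (abs_cast_le_norm q₀ j) (abs_nonneg (l v : ℝ))
        linarith [hlT v, abs_cast_le_norm (q v) j, hq v]
      have h2 : (r v j).natAbs ≤ M := by
        refine Nat.le_floor ?_
        rwa [Nat.cast_natAbs, Int.cast_abs]
      rw [Finset.mem_Icc]
      omega
  have hcard : K ^ m ≤ S.card := by
    have := Finset.card_le_card_of_injOn (s := Finset.univ) (t := S) r (fun v _ => hmem v)
      hinj.injOn
    simpa using this
  have hS : S.card = (q₀ i₀).natAbs * (2 * M + 1) ^ (n - 1) := by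
    rw [Fintype.card_piFinset, ← Finset.mul_prod_erase _ _ (Finset.mem_univ i₀), if_pos rfl,
      Finset.prod_congr rfl fun j hj => by rw [if_neg (Finset.ne_of_mem_erase hj)],
      Finset.prod_const, Finset.card_erase_of_mem (Finset.mem_univ _), Finset.card_univ,
      Fintype.card_fin, Int.card_Ico, Int.card_Icc]
    congr 2
    · rw [Int.abs_eq_natAbs]; omega
    · omega
  have hM7 : 2 * (M : ℝ) + 1 ≤ 7 * Q := by
    have : (M : ℝ) ≤ 3 * Q := Nat.floor_le (by linarith)
    linarith
  have hKr : (K : ℝ) ^ m ≤ ‖q₀‖ * (2 * M + 1) ^ (n - 1) := by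
    rw [hS] at hcard
    rw [← hi₀, ← Int.cast_abs, ← Nat.cast_natAbs]
    exact_mod_cast hcard
  calc (K : ℝ) ^ m * (7 * Q) ≤ ‖q₀‖ * (7 * Q) ^ (n - 1) * (7 * Q) := by
        gcongr
        exact hKr.trans (by gcongr)
    _ = ‖q₀‖ * (7 * Q) ^ n := by
        rw [mul_assoc, ← pow_succ, Nat.sub_add_cancel hn]

/-- For `w ≥ 0` the error is at most `1`, so a bound on `q` also bounds `p` and leaves finitely many
pairs. -/
theorem exists_mem_approxPairs_norm_ge {m n : ℕ} {A : Matrix (Fin m) (Fin n) ℝ} {w : ℝ}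
    (hw : 0 ≤ w) (hinf : (approxPairs A w).Infinite) (X : ℝ) :
    ∃ x ∈ approxPairs A w, X ≤ ‖x.2‖ := by
  by_contra! hcon
  have hball {k : ℕ} (R : ℝ) : (Metric.closedBall (0 : Fin k → ℤ) R).Finite :=
    isCompact_iff_finite.1 (isCompact_closedBall _ _)
  refine hinf (((hball X).biUnion fun q _ =>
    (hball (1 + ‖matMulInt A q‖)).image fun p : Fin m → ℤ => (p, q)).subset ?_)
  rintro ⟨p, q⟩ hx
  refine Set.mem_biUnion (x := q) ?_ ⟨p, ?_, rfl⟩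
  · simpa using (hcon _ hx).le
  · rw [mem_closedBall_zero_iff, ← intVec_norm]
    have h1 : ‖q‖ ^ (-w) ≤ 1 :=
      Real.rpow_le_one_of_one_le_of_nonpos (one_le_norm_of_ne_zero hx.1) (by linarith)
    have h2 : ‖matMulInt A q + intVec p‖ ≤ ‖q‖ ^ (-w) := hx.2
    have h3 := norm_sub_le (matMulInt A q + intVec p) (matMulInt A q)
    rw [add_sub_cancel_left] at h3
    linarith

theorem not_veryWellApproximable_of_inhomogeneous {m n : ℕ} (hm : 0 < m) (hn : 0 < n)
    {A : Matrix (Fin m) (Fin n) ℝ}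
    (h : ∀ ε : ℝ, 0 < ε → ∃ c : ℝ, 0 < c ∧ ∃ Q₀ : ℝ, 0 < Q₀ ∧ ∀ Q : ℝ, Q₀ ≤ Q →
      ∀ γ : Fin m → ℝ, ∃ (q : Fin n → ℤ) (p : Fin m → ℤ),
        ‖q‖ < Q ∧ ‖matMulInt A q - intVec p - γ‖ < c / Q ^ ((n : ℝ) / (m : ℝ) - ε)) :
    ¬ VeryWellApproximable A := by
  intro hA
  obtain ⟨w, hw, hinf⟩ := exists_infinite_approxPairs hA
  have hm' : (0 : ℝ) < m := by exact_mod_cast hm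
  have hn1 : (1 : ℝ) ≤ n := by exact_mod_cast hn
  obtain ⟨a, ha⟩ : ∃ a : ℝ, a = n / m := ⟨_, rfl⟩
  have ha0 : 0 < a := by rw [ha]; positivity
  have ham : a * m = n := by rw [ha]; field_simp
  rw [← ha] at h hw
  -- With `Q = T^(1+η)`, this `η` makes `T^(η-w)` negligible against `T^(-b)`; the `ε` below leaves
  -- a surplus factor `T^(η/2)` in the count, which must eventually exceed any constant.
  obtain ⟨η, hη⟩ : ∃ η : ℝ, η = (w - a) / (2 * (1 + a)) := ⟨_, rfl⟩
  have hη0 : 0 < η := by rw [hη]; exact div_pos (by linarith) (by linarith)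
  have hηa : η * (1 + a) = (w - a) / 2 := by rw [hη]; field_simp
  obtain ⟨ε, hε⟩ : ∃ ε : ℝ, ε = η / (2 * m * (1 + η)) := ⟨_, rfl⟩
  have hε0 : 0 < ε := by rw [hε]; positivity
  have hmε : m * ε * (1 + η) = η / 2 := by rw [hε]; field_simp
  have hεa : ε < a := by
    have h1 : ε * m < 1 := by nlinarith
    nlinarith
  set b : ℝ := (1 + η) * (a - ε) with hb
  have hb0 : 0 < b := mul_pos (by linarith) (by linarith)
  have hwb : 0 < w - η - b := by
    rw [hb]; nlinarith
  obtain ⟨c, hc, Q₀, -, hQ⟩ := h ε hε0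
  have hlarge : ∀ᶠ T : ℝ in Filter.atTop, Q₀ ≤ T ∧ 2 / c ≤ T ^ (w - η - b) ∧ 4 * c ≤ T ^ b ∧
      (8 * c) ^ m * 7 ^ n < T ^ (η / 2) :=
    (Filter.eventually_ge_atTop Q₀).and
      (((tendsto_rpow_atTop hwb).eventually_ge_atTop _).and
        (((tendsto_rpow_atTop hb0).eventually_ge_atTop _).and
          ((tendsto_rpow_atTop (half_pos hη0)).eventually_gt_atTop _)))
  obtain ⟨X, hX⟩ := Filter.eventually_atTop.1 hlarge
  obtain ⟨⟨p₀, q₀⟩, ⟨hq₀, hp₀⟩, hXq⟩ := exists_mem_approxPairs_norm_ge (by linarith) hinf X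
  simp only at hq₀ hp₀ hXq
  obtain ⟨hT₁, hT₂, hT₃, hT₄⟩ := hX _ hXq
  have hT1 := one_le_norm_of_ne_zero hq₀
  generalize hT : ‖q₀‖ = T at *
  have hT0 : 0 < T := by linarith
  have hTQ : T ≤ T ^ (1 + η) := Real.self_le_rpow_of_one_le hT1 (by linarith)
  have hQb : (T ^ (1 + η)) ^ (a - ε) = T ^ b := by rw [← Real.rpow_mul hT0.le]
  have hTb0 : 0 < T ^ b := by positivity
  have hdense := hQ (T ^ (1 + η)) (hT₁.trans hTQ)
  rw [hQb] at hdense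
  set Y : ℝ := T ^ b / (4 * c) with hY
  have hY1 : 1 ≤ Y := (one_le_div (by positivity)).2 hT₃
  have hKY : (⌊Y⌋₊ : ℝ) ≤ Y := Nat.floor_le (by linarith)
  have hYK : Y < 2 * ⌊Y⌋₊ := by
    have h1 := Nat.lt_floor_add_one Y
    have h2 : (1 : ℝ) ≤ ⌊Y⌋₊ := by exact_mod_cast (Nat.one_le_floor_iff Y).2 hY1
    linarith
  have hcount := pow_mul_le_of_dense hn (p₀ := p₀) hq₀ (hT.trans_le hTQ) (K := ⌊Y⌋₊)
    ?_ ?_ hdense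
  · rw [hT] at hcount
    have hKlow : T ^ b / (8 * c) ≤ ⌊Y⌋₊ := by
      have : T ^ b / (8 * c) = Y / 2 := by rw [hY]; field_simp; norm_num
      linarith
    have h1 : (T ^ b / (8 * c)) ^ m * (7 * T ^ (1 + η)) ≤ T * (7 * T ^ (1 + η)) ^ n :=
      le_trans (by gcongr) hcount
    have e1 : (T ^ b) ^ m * T ^ (1 + η) = T * (T ^ (1 + η)) ^ n * T ^ (η / 2) := by
      rw [← Real.rpow_natCast, ← Real.rpow_natCast, ← Real.rpow_mul hT0.le,
        ← Real.rpow_mul hT0.le, ← Real.rpow_add hT0]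
      nth_rw 2 [← Real.rpow_one T]
      rw [← Real.rpow_add hT0, ← Real.rpow_add hT0]
      congr 1
      rw [hb]
      linear_combination (1 + η) * ham - hmε
    rw [div_pow, div_mul_eq_mul_div, div_le_iff₀ (by positivity), mul_pow 7] at h1
    have e2 : (T ^ b) ^ m * (7 * T ^ (1 + η)) = 7 * T ^ (η / 2) * (T * (T ^ (1 + η)) ^ n) := by
      linear_combination 7 * e1
    have e3 : T * (7 ^ n * (T ^ (1 + η)) ^ n) * (8 * c) ^ m
        = (8 * c) ^ m * 7 ^ n * (T * (T ^ (1 + η)) ^ n) := by ring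
    rw [e2, e3] at h1
    have h2 := le_of_mul_le_mul_right h1 (by positivity)
    have : 0 < T ^ (η / 2) := by positivity
    linarith
  · calc 4 * (c / T ^ b) * ⌊Y⌋₊ ≤ 4 * (c / T ^ b) * Y := by gcongr
      _ = 1 := by rw [hY]; field_simp
  · rw [hT]
    calc 2 * (T ^ (1 + η) / T) * ‖matMulInt A q₀ + intVec p₀‖
        ≤ 2 * (T ^ (1 + η) / T) * T ^ (-w) := by gcongr
      _ = 2 * T ^ (η - w) := by
          rw [add_comm, Real.rpow_add hT0, Real.rpow_one, mul_div_cancel_right₀ _ hT0.ne',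
            mul_assoc, ← Real.rpow_add hT0, sub_eq_add_neg]
      _ = 2 / c * (c * T ^ (η - w)) := by field_simp
      _ ≤ T ^ (w - η - b) * (c * T ^ (η - w)) := by gcongr
      _ = c * T ^ (-b) := by
          rw [mul_left_comm, ← Real.rpow_add hT0]
          congr 2; ring
      _ = c / T ^ b := by rw [Real.rpow_neg hT0.le, div_eq_mul_inv]

end Converse

theorem theorem2p2 (m n : ℕ) (hm : 0 < m) (hn : 0 < n) (A : Matrix (Fin m) (Fin n) ℝ) :
    ¬ VeryWellApproximable A ↔
      ∀ ε : ℝ, 0 < ε → ∃ c : ℝ, 0 < c ∧ ∃ Q₀ : ℝ, 0 < Q₀ ∧ ∀ Q : ℝ, Q₀ ≤ Q →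
        ∀ γ : Fin m → ℝ, ∃ (q : Fin n → ℤ) (p : Fin m → ℤ),
          ‖q‖ < Q ∧ ‖matMulInt A q - intVec p - γ‖ < c / Q ^ ((n : ℝ) / (m : ℝ) - ε) :=
  ⟨fun hA _ hε => exists_inhomogeneous_approx hm hn hA hε,
    not_veryWellApproximable_of_inhomogeneous hm hn⟩
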